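/- Let $\Gamma$ be a non-solvable subgroup of $SL_2(\mathbb{R})$ that preserves the lattice $\mathbb{Z}^2 \subset \mathbb{R}^2$ (equivalently, all matrices in $\Gamma$ have integer entries, i.e. $\Gamma \subset SL_2(\mathbb{Z})$), and let $\Gamma \ltimes \mathbb{Z}^2$ be the semidirect product given by the linear action $v \mapsto Av$ of $\Gamma$ on $\mathbb{Z}^2$. Then $\Gamma \ltimes \mathbb{Z}^2$ does not embed into the group $\mathrm{Diff}^1_+([0,1])$ of orientation-preserving $C^1$ diffeomorphisms of the closed interval $[0,1]$; that is, there is no injective group homomorphism $\Gamma \ltimes \mathbb{Z}^2 \to \mathrm{Diff}^1_+([0,1])$. -/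

import Mathlib

open scoped MatrixGroups

/-- The standard lattice `ℤ²` in `ℝ²`: the vectors with integer coordinates. -/
def intLattice : AddSubgroup (Fin 2 → ℝ) where
  carrier := {v | ∃ w : Fin 2 → ℤ, ∀ i, v i = w i}
  add_mem' := by
    rintro _ _ ⟨w, hw⟩ ⟨w', hw'⟩
    exact ⟨w + w', fun i => by simp [hw, hw']⟩
  zero_mem' := ⟨0, fun i => by simp⟩
  neg_mem' := by
    rintro _ ⟨w, hw⟩
    exact ⟨-w, fun i => by simp [hw]⟩

/-- `Γ` acts on `ℤ²` by matrix multiplication: every matrix of `Γ` maps `ℤ²` into itself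
(equivalently, has integer entries). -/
def PreservesIntLattice (Γ : Subgroup SL(2, ℝ)) : Prop :=
  ∀ A ∈ Γ, ∀ v ∈ intLattice, (A : Matrix (Fin 2) (Fin 2) ℝ).mulVec v ∈ intLattice

/-- The linear action `v ↦ A v` of `Γ` on `ℤ²`, as a homomorphism from `Γ` to the automorphism
group of `ℤ²` (written multiplicatively). -/
def latticeAction (Γ : Subgroup SL(2, ℝ)) (hΓ : PreservesIntLattice Γ) :
    Γ →* MulAut (Multiplicative intLattice) where
  toFun A :=
    { toFun := fun v => Multiplicative.ofAdd
        ⟨(A : Matrix (Fin 2) (Fin 2) ℝ).mulVec v.toAdd, hΓ A A.2 _ v.toAdd.2⟩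
      invFun := fun v => Multiplicative.ofAdd
        ⟨((A⁻¹ : Γ) : Matrix (Fin 2) (Fin 2) ℝ).mulVec v.toAdd, hΓ _ (A⁻¹).2 _ v.toAdd.2⟩
      left_inv := fun v => by
        apply Multiplicative.toAdd.injective
        apply Subtype.ext
        change ((A⁻¹ : Γ) : Matrix (Fin 2) (Fin 2) ℝ).mulVec
          ((A : Matrix (Fin 2) (Fin 2) ℝ).mulVec (v.toAdd : Fin 2 → ℝ)) = v.toAdd
        rw [Matrix.mulVec_mulVec, ← Matrix.SpecialLinearGroup.coe_mul, ← Subgroup.coe_mul]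
        simp
      right_inv := fun v => by
        apply Multiplicative.toAdd.injective
        apply Subtype.ext
        change (A : Matrix (Fin 2) (Fin 2) ℝ).mulVec
          (((A⁻¹ : Γ) : Matrix (Fin 2) (Fin 2) ℝ).mulVec (v.toAdd : Fin 2 → ℝ)) = v.toAdd
        rw [Matrix.mulVec_mulVec, ← Matrix.SpecialLinearGroup.coe_mul, ← Subgroup.coe_mul]
        simp
      map_mul' := fun v w => by
        apply Multiplicative.toAdd.injective
        apply Subtype.ext
        exact Matrix.mulVec_add (A : Matrix (Fin 2) (Fin 2) ℝ) v.toAdd w.toAdd }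
  map_one' := by
    ext1 v
    apply Multiplicative.toAdd.injective
    apply Subtype.ext
    exact Matrix.one_mulVec (v.toAdd : Fin 2 → ℝ)
  map_mul' A B := by
    ext1 v
    apply Multiplicative.toAdd.injective
    apply Subtype.ext
    exact (Matrix.mulVec_mulVec (v.toAdd : Fin 2 → ℝ) (A : Matrix (Fin 2) (Fin 2) ℝ)
      (B : Matrix (Fin 2) (Fin 2) ℝ)).symm

/-- The semidirect product `Γ ⋉ ℤ²` for the linear action of `Γ` on `ℤ²`. -/
abbrev LatticeSemidirect (Γ : Subgroup SL(2, ℝ)) (hΓ : PreservesIntLattice Γ) : Type :=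
  Multiplicative intLattice ⋊[latticeAction Γ hΓ] Γ

/-- A map `f : [0,1] → [0,1]` is of class `C¹` on the closed interval (with one-sided derivatives
at the endpoints): the extension of `f` to `ℝ` that is constant on both sides of the interval
is continuously differentiable on, and relative to, `[0,1]`. -/
def IsC1 (f : Set.Icc (0 : ℝ) 1 → Set.Icc (0 : ℝ) 1) : Prop :=
  ContDiffOn ℝ 1 (fun x : ℝ => (f (Set.projIcc 0 1 zero_le_one x) : ℝ)) (Set.Icc 0 1)

theorem isC1_id : IsC1 id := by
  refine contDiffOn_id.congr fun x hx => ?_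
  simp [Set.projIcc_of_mem zero_le_one hx]

theorem IsC1.comp {f g : Set.Icc (0 : ℝ) 1 → Set.Icc (0 : ℝ) 1} (hf : IsC1 f) (hg : IsC1 g) :
    IsC1 (f ∘ g) := by
  refine (ContDiffOn.comp hf hg fun x _ => (g _).2).congr fun x _ => ?_
  simp

/-- The group of orientation-preserving `C¹` diffeomorphisms of `[0,1]`: the increasing bijections
of `[0,1]` that are of class `C¹` together with their inverse. -/
def Diff1Plus : Subgroup (Equiv.Perm (Set.Icc (0 : ℝ) 1)) where
  carrier := {f | StrictMono f ∧ IsC1 f ∧ IsC1 f.symm}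
  mul_mem' := by
    rintro f g ⟨hf, hf1, hf2⟩ ⟨hg, hg1, hg2⟩
    exact ⟨hf.comp hg, hf1.comp hg1, hg2.comp hf2⟩
  one_mem' := ⟨strictMono_id, isC1_id, isC1_id⟩
  inv_mem' := by
    rintro f ⟨hf, hf1, hf2⟩
    refine ⟨fun x y hxy => ?_, hf2, hf1⟩
    rw [← hf.lt_iff_lt]
    change f (f.symm x) < f (f.symm y)
    simpa using hxy

open Set Filter Topology Matrix

/-! Suppose an embedding exists, and let `Δ` be the part of `Γ` congruent to the identity mod 2. As
`Γ/Δ` embeds in the solvable group `SL(2, ZMod 2)`, it suffices that `Δ` is solvable. Traces in `Δ`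
are 2 mod 4. If all are ±2, `Δ` has a common eigenvector or is scalar. Otherwise `Δ` contains a
hyperbolic matrix.

Let `(a,b)` be a component of the complement of the fixed points of `ℤ²`. Comparing displacements
there gives `ℤ²` a total archimedean preorder. By Hölder's theorem it carries a nonzero monotone
functional `τ`, unique up to a factor. If all of `Δ` fixes `(a,b)`, then `Δ` preserves the preorder,
so `τ` is a common row eigenvector and `Δ` is solvable.

The `C¹` hypothesis makes hyperbolic elements fix the gap (`IsIntervalDiffeo.false_of_expanding`).
Suppose `g` moves the gap off itself. The images under `gⁿ` are then disjoint and shrink to length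
zero. After replacing `g` by its inverse if needed, conjugation by `g` more than doubles a positive
`v` at every step. On short intervals `g` is almost affine, and `h = ψ v`, which fixes both
endpoints, has slope almost 1. So the displacement of `h` relative to the length of the interval
grows geometrically, yet it is at most 1. The identity `tr(AB) + tr(A⁻¹B) = tr A · tr B` then
extends the conclusion from hyperbolic elements to all of `Δ`. -/

/-! ### Interval diffeomorphisms and the `C¹` distortion estimate. -/

/-- An order isomorphism of `ℝ` that is the identity outside `(0,1)` and restricts to a `C¹`
diffeomorphism of `[0,1]`. -/
structure IsIntervalDiffeo (f : ℝ ≃o ℝ) : Prop where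
  contDiffOn : ContDiffOn ℝ 1 f (Icc 0 1)
  contDiffOn_inv : ContDiffOn ℝ 1 (f⁻¹ : ℝ ≃o ℝ) (Icc 0 1)
  eq_self : ∀ x, x ∉ Ioo (0 : ℝ) 1 → f x = x

theorem IsIntervalDiffeo.map_zero {f : ℝ ≃o ℝ} (hf : IsIntervalDiffeo f) : f 0 = 0 :=
  hf.eq_self 0 (by simp)

theorem IsIntervalDiffeo.map_one {f : ℝ ≃o ℝ} (hf : IsIntervalDiffeo f) : f 1 = 1 :=
  hf.eq_self 1 (by simp)

theorem IsIntervalDiffeo.pow_zero {f : ℝ ≃o ℝ} (hf : IsIntervalDiffeo f) (n : ℕ) :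
    (f ^ n) 0 = 0 := by
  induction n with
  | zero => simp
  | succ n ih => rw [pow_succ', RelIso.mul_apply, ih, hf.map_zero]

theorem IsIntervalDiffeo.pow_one {f : ℝ ≃o ℝ} (hf : IsIntervalDiffeo f) (n : ℕ) :
    (f ^ n) 1 = 1 := by
  induction n with
  | zero => simp
  | succ n ih => rw [pow_succ', RelIso.mul_apply, ih, hf.map_one]

/-- On short intervals, the secant slopes of a `C¹` function are uniformly close to each other. -/
theorem ContDiffOn.exists_secant_close {f : ℝ → ℝ} (hf : ContDiffOn ℝ 1 f (Icc 0 1)) {ε : ℝ}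
    (hε : 0 < ε) : ∃ δ > 0, ∀ p q, 0 ≤ p → q ≤ 1 → q - p < δ →
      ∀ x y x' y', p ≤ x → x < y → y ≤ q → p ≤ x' → x' < y' → y' ≤ q →
        |(f y - f x) / (y - x) - (f y' - f x') / (y' - x')| < ε := by
  have hu : UniformContinuousOn (derivWithin f (Icc 0 1)) (Icc 0 1) :=
    isCompact_Icc.uniformContinuousOn_of_continuous
      (hf.continuousOn_derivWithin (uniqueDiffOn_Icc zero_lt_one) le_rfl)
  have slope : ∀ x y, 0 ≤ x → x < y → y ≤ 1 →
      ∃ c ∈ Ioo x y, derivWithin f (Icc 0 1) c = (f y - f x) / (y - x) := by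
    intro x y hx hxy hy
    have hsub : Icc x y ⊆ Icc 0 1 := Icc_subset_Icc hx hy
    obtain ⟨c, hc, hc'⟩ := exists_deriv_eq_slope f hxy (hf.continuousOn.mono hsub)
      ((hf.differentiableOn one_ne_zero).mono (Ioo_subset_Icc_self.trans hsub) |>.congr_mono
        (fun _ _ => rfl) subset_rfl)
    refine ⟨c, hc, ?_⟩
    rw [← hc', derivWithin_of_mem_nhds]
    exact Icc_mem_nhds (hx.trans_lt hc.1) (hc.2.trans_le hy)
  obtain ⟨δ, hδ, H⟩ := Metric.uniformContinuousOn_iff.1 hu ε hε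
  refine ⟨δ, hδ, fun p q hp hq hpq x y x' y' h1 h2 h3 h4 h5 h6 => ?_⟩
  obtain ⟨c, hc, hc'⟩ := slope x y (hp.trans h1) h2 (h3.trans hq)
  obtain ⟨d, hd, hd'⟩ := slope x' y' (hp.trans h4) h5 (h6.trans hq)
  rw [← hc', ← hd', ← Real.dist_eq]
  refine H c ⟨?_, ?_⟩ d ⟨?_, ?_⟩ ?_
  iterate 4 linarith [hc.1, hc.2, hd.1, hd.2]
  rw [Real.dist_eq, abs_lt]
  constructor <;> linarith [hc.1, hc.2, hd.1, hd.2]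

/-- The left endpoints form a bounded monotone sequence, and disjointness bounds each length by the
difference of two consecutive ones. -/
theorem IsIntervalDiffeo.tendsto_length {g : ℝ ≃o ℝ} (hg : IsIntervalDiffeo g) {a b : ℝ}
    (ha : 0 ≤ a) (hab : a < b) (hb : b ≤ 1) (hga : b ≤ g a ∨ g b ≤ a) :
    Tendsto (fun n : ℕ => (g ^ n) b - (g ^ n) a) atTop (𝓝 0) := by
  have h0 : ∀ n : ℕ, 0 ≤ (g ^ n) a := fun n => by
    rw [← hg.pow_zero n]; exact (g ^ n).monotone ha
  have h1 : ∀ n : ℕ, (g ^ n) a ≤ 1 := fun n => by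
    rw [← hg.pow_one n]; exact (g ^ n).monotone (hab.le.trans hb)
  have hlen : ∀ n : ℕ, 0 ≤ (g ^ n) b - (g ^ n) a := fun n =>
    sub_nonneg.2 ((g ^ n).monotone hab.le)
  have hstep : ∀ (n : ℕ) (x : ℝ), (g ^ (n + 1)) x = (g ^ n) (g x) := fun n x => by
    rw [pow_succ, RelIso.mul_apply]
  rcases hga with h | h
  · have hmono : Monotone fun n : ℕ => (g ^ n) a := monotone_nat_of_le_succ fun n => by
      simp only [hstep]; exact (g ^ n).monotone (hab.le.trans h)
    have ht := tendsto_atTop_ciSup hmono ⟨1, by rintro _ ⟨n, rfl⟩; exact h1 n⟩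
    have hd := (ht.comp (tendsto_add_atTop_nat 1)).sub ht
    rw [sub_self] at hd
    refine squeeze_zero hlen (fun n => ?_) hd
    simp only [Function.comp, hstep]
    exact sub_le_sub_right ((g ^ n).monotone h) _
  · have hmono : Antitone fun n : ℕ => (g ^ n) a := antitone_nat_of_succ_le fun n => by
      simp only [hstep]; exact (g ^ n).monotone ((g.monotone hab.le).trans h)
    have ht := tendsto_atTop_ciInf hmono ⟨0, by rintro _ ⟨n, rfl⟩; exact h0 n⟩
    have hd := ht.sub (ht.comp (tendsto_add_atTop_nat 1))
    rw [sub_self] at hd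
    refine (tendsto_add_atTop_iff_nat 1).1 (squeeze_zero (fun n => hlen (n + 1)) (fun n => ?_) hd)
    simp only [Function.comp, hstep]
    exact sub_le_sub_right ((g ^ n).monotone h) _

/-- If the intervals `gⁿ(a,b)` are disjoint and `h` fixes their endpoints, then conjugation by `g`
cannot keep turning `h` into something larger than `h²` along these intervals. -/
theorem IsIntervalDiffeo.false_of_expanding {g h : ℝ ≃o ℝ} (hg : IsIntervalDiffeo g)
    (hh : IsIntervalDiffeo h) {a b : ℝ} (ha : 0 ≤ a) (hab : a < b) (hb : b ≤ 1)
    (hga : b ≤ g a ∨ g b ≤ a)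
    (hha : ∀ n : ℕ, h ((g ^ n) a) = (g ^ n) a) (hhb : ∀ n : ℕ, h ((g ^ n) b) = (g ^ n) b)
    (hpos : ∀ n : ℕ, ∀ x ∈ Ioo a b, (g ^ n) x < h ((g ^ n) x))
    (hexp : ∀ n : ℕ, ∀ x ∈ Ioo a b, g (h (h ((g ^ n) x))) < h ((g ^ (n + 1)) x)) : False := by
  obtain ⟨K, hK⟩ := hg.contDiffOn_inv.exists_lipschitzOnWith one_ne_zero (convex_Icc 0 1)
    isCompact_Icc
  have hstep : ∀ (n : ℕ) (x : ℝ), (g ^ (n + 1)) x = g ((g ^ n) x) := fun n x => by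
    rw [pow_succ', RelIso.mul_apply]
  have h0 : ∀ n : ℕ, 0 ≤ (g ^ n) a := fun n => by
    rw [← hg.pow_zero n]; exact (g ^ n).monotone ha
  have h1 : ∀ n : ℕ, (g ^ n) b ≤ 1 := fun n => by
    rw [← hg.pow_one n]; exact (g ^ n).monotone hb
  have hlt : ∀ n : ℕ, (g ^ n) a < (g ^ n) b := fun n => (g ^ n).strictMono hab
  -- the inverse of `g` is Lipschitz, so `g` contracts no interval by more than `L`
  set L : ℝ := (K : ℝ) + 1
  have hL : 0 < L := by positivity
  have hslope : ∀ n : ℕ, L⁻¹ ≤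
      ((g ^ (n + 1)) b - (g ^ (n + 1)) a) / ((g ^ n) b - (g ^ n) a) := by
    intro n
    have hp := hlt n
    have hp' := hlt (n + 1)
    rw [le_div_iff₀ (sub_pos.2 hp), inv_mul_le_iff₀ hL]
    have := hK.dist_le_mul _ ⟨(h0 (n + 1)).trans hp'.le, h1 (n + 1)⟩ _
      ⟨h0 (n + 1), hp'.le.trans (h1 (n + 1))⟩
    rw [hstep, hstep, RelIso.inv_apply_self, RelIso.inv_apply_self, ← hstep, ← hstep,
      Real.dist_eq, Real.dist_eq, abs_of_pos (sub_pos.2 hp), abs_of_pos (sub_pos.2 hp')] at this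
    exact this.trans (mul_le_mul_of_nonneg_right (by simp [L]) (sub_pos.2 hp').le)
  obtain ⟨δ₁, hδ₁, H₁⟩ := hh.contDiffOn.exists_secant_close (ε := 1 / 8) (by norm_num)
  -- The mean slope of `g` on each interval is at least `L⁻¹`, so this error is at most one eighth
  -- of that slope.
  obtain ⟨δ₂, hδ₂, H₂⟩ := hg.contDiffOn.exists_secant_close (ε := L⁻¹ / 8) (by positivity)
  obtain ⟨N, hN⟩ := eventually_atTop.1
    ((hg.tendsto_length ha hab hb hga).eventually_lt_const (lt_min hδ₁ hδ₂))
  obtain ⟨x, hx⟩ := exists_between hab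
  have hxI : x ∈ Ioo a b := hx
  -- Displacement of `h` at the `n`-th image of `x`, relative to the length of the `n`-th interval.
  set d : ℕ → ℝ := fun n => (h ((g ^ n) x) - (g ^ n) x) / ((g ^ n) b - (g ^ n) a) with hd
  have hdpos : ∀ n, 0 < d n := fun n =>
    div_pos (sub_pos.2 (hpos n x hxI)) (sub_pos.2 (hlt n))
  have hdle : ∀ n, d n ≤ 1 := by
    intro n
    rw [hd]
    refine (div_le_one (sub_pos.2 (hlt n))).2 (sub_le_sub ?_ ((g ^ n).monotone hx.1.le))
    rw [← hhb n]
    exact h.monotone ((g ^ n).monotone hx.2.le)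
  have hgrow : ∀ n, N ≤ n → 3 / 2 * d n ≤ d (n + 1) := by
    intro n hn
    have hlen := hN n hn
    have e1 := hexp n x hxI
    have e0 := hpos n x hxI
    have ex : (g ^ n) a < (g ^ n) x := (g ^ n).strictMono hx.1
    have ey : h ((g ^ n) x) < (g ^ n) b := by
      rw [← hhb n]; exact h.strictMono ((g ^ n).strictMono hx.2)
    have ez : h (h ((g ^ n) x)) < (g ^ n) b := by
      nth_rw 1 [← hhb n]; exact h.strictMono ey
    have eyz : h ((g ^ n) x) < h (h ((g ^ n) x)) := h.strictMono e0
    have k1 := H₁ _ _ (h0 n) (h1 n) (hlen.trans_le (min_le_left _ _)) _ _ _ _ ex.le e0 ey.le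
      le_rfl (hlt n) le_rfl
    have k2 := H₂ _ _ (h0 n) (h1 n) (hlen.trans_le (min_le_right _ _)) _ _ _ _ ex.le
      (e0.trans eyz) ez.le le_rfl (hlt n) le_rfl
    have hs := hslope n
    -- Since `h` fixes both endpoints, its secant slope over the whole interval is 1.
    rw [hha, hhb, div_self (sub_pos.2 (hlt n)).ne'] at k1
    rw [← hstep, ← hstep, ← hstep] at k2
    rw [hd]
    dsimp only
    have p1 := hlt (n + 1)
    have p0 := hlt n
    generalize (g ^ n) a = a₀ at *
    generalize (g ^ n) b = b₀ at *
    generalize (g ^ n) x = x₀ at *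
    generalize (g ^ (n + 1)) a = a₁ at *
    generalize (g ^ (n + 1)) b = b₁ at *
    generalize (g ^ (n + 1)) x = x₁ at *
    generalize h x₁ = y₁ at *
    generalize h (h x₀) = z₀ at *
    generalize h x₀ = y₀ at *
    generalize g z₀ = w at *
    set s := (b₁ - a₁) / (b₀ - a₀)
    have q0 : 0 < b₀ - a₀ := sub_pos.2 p0
    have q1 : 0 < b₁ - a₁ := sub_pos.2 p1
    have hs0 : 0 < s := div_pos q1 q0
    have k1' := (abs_lt.1 k1).1
    have k2' := (abs_lt.1 k2).1
    have k1'' : 7 / 8 * (y₀ - x₀) ≤ z₀ - y₀ := by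
      rw [← le_div_iff₀ (sub_pos.2 e0)]; linarith
    have k2'' : 7 / 8 * s * (z₀ - x₀) ≤ w - x₁ := by
      rw [← le_div_iff₀ (by linarith)]; linarith
    have hb₁ : b₁ - a₁ = s * (b₀ - a₀) := (div_mul_cancel₀ _ q0.ne').symm
    rw [le_div_iff₀ q1, hb₁, show 3 / 2 * ((y₀ - x₀) / (b₀ - a₀)) * (s * (b₀ - a₀)) =
      s * (3 / 2 * (y₀ - x₀)) by field_simp]
    -- Two displacements of `h` cover at least `1 + 7/8` of the first, and `7/8 * (1 + 7/8) > 3/2`.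
    have : s * (3 / 2 * (y₀ - x₀)) ≤ s * (7 / 8 * (z₀ - x₀)) :=
      mul_le_mul_of_nonneg_left (by linarith) hs0.le
    linarith
  have hpow : ∀ k : ℕ, (3 / 2 : ℝ) ^ k * d N ≤ d (N + k) := by
    intro k
    induction k with
    | zero => simp
    | succ k ih =>
      have := hgrow (N + k) (by omega)
      rw [pow_succ, ← add_assoc]
      linarith
  obtain ⟨k, hk⟩ := pow_unbounded_of_one_lt (1 / d N) (show (1 : ℝ) < 3 / 2 by norm_num)
  rw [div_lt_iff₀ (hdpos N)] at hk
  linarith [hpow k, hdle (N + k)]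

/-! ### The preorder defined by an abelian action on a gap. -/

section AbelianAction

/-- Two commuting order isomorphisms of `ℝ`, each with a fixed point in `(a,b)`, have a common one. -/
theorem Commute.exists_common_fixed {f g : ℝ ≃o ℝ} (hfg : Commute f g) {a b x y : ℝ}
    (hx : x ∈ Ioo a b) (hy : y ∈ Ioo a b) (hfx : f x = x) (hgy : g y = y) :
    ∃ z ∈ Ioo a b, f z = z ∧ g z = z := by
  wlog hxy : x ≤ y generalizing f g x y
  · obtain ⟨z, hz, h1, h2⟩ := this hfg.symm hy hx hgy hfx (le_of_not_ge hxy)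
    exact ⟨z, hz, h2, h1⟩
  have hcl : IsClosed {w | f w = w} := isClosed_eq f.continuous continuous_id
  obtain ⟨z, ⟨hz, hfz⟩, hmax⟩ := (isCompact_Icc (a := x) (b := y)).inter_right hcl
    |>.exists_isGreatest ⟨x, ⟨le_rfl, hxy⟩, hfx⟩
  simp only [mem_ofPred_eq] at hfz
  -- `k` permutes the fixed points of `f` and keeps `k z` below `y`, so maximality of `z` applies to
  -- `k z`. It is used for `g` and `g⁻¹`.
  have key : ∀ k : ℝ ≃o ℝ, Commute f k → k y = y → k z ≤ z := by
    intro k hk hky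
    by_contra! hlt
    refine hlt.not_ge (hmax ⟨⟨hz.1.trans hlt.le, ?_⟩, ?_⟩)
    · rw [← hky]; exact k.monotone hz.2
    · have := DFunLike.congr_fun hk.eq z
      rwa [RelIso.mul_apply, RelIso.mul_apply, hfz] at this
  refine ⟨z, ⟨hx.1.trans_le hz.1, hz.2.trans_lt hy.2⟩, hfz, (key g hfg hgy).antisymm ?_⟩
  have := g.monotone (key g⁻¹ hfg.inv_right (by
    nth_rw 1 [← hgy]; exact RelIso.inv_apply_self g y))
  rwa [RelIso.apply_inv_self] at this

theorem OrderIso.exists_fixed_Ioo (f : ℝ ≃o ℝ) {a b x y : ℝ} (hx : x ∈ Ioo a b)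
    (hy : y ∈ Ioo a b) (hfx : x ≤ f x) (hfy : f y ≤ y) : ∃ z ∈ Ioo a b, f z = z := by
  obtain ⟨z, hz, h⟩ := isPreconnected_Ioo.intermediate_value₂ hx hy continuousOn_id
    f.continuous.continuousOn hfx hfy
  exact ⟨z, hz, h.symm⟩

variable {V : Type*} [AddCommGroup V]

/-- `(a,b)` is a component of the complement of the global fixed point set of the action `ψ`. -/
structure IsGap (ψ : Multiplicative V →* (ℝ ≃o ℝ)) (a b : ℝ) : Prop where
  lt : a < b
  left : ∀ v, ψ v a = a
  right : ∀ v, ψ v b = b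
  exists_ne : ∀ x ∈ Ioo a b, ∃ v, ψ v x ≠ x

/-- The elements that do not move every point of `(a,b)` to the left. -/
def nonnegOn (ψ : Multiplicative V →* (ℝ ≃o ℝ)) (a b : ℝ) (hab : a < b) : AddSubmonoid V where
  carrier := {v | ∃ x ∈ Ioo a b, x ≤ ψ (.ofAdd v) x}
  zero_mem' := by
    obtain ⟨x, hx⟩ := exists_between hab
    exact ⟨x, hx, by simp⟩
  add_mem' := by
    rintro v w ⟨x, hx, hvx⟩ ⟨y, hy, hwy⟩
    have hcomm : Commute (ψ (.ofAdd v)) (ψ (.ofAdd w)) := (Commute.all _ _).map ψ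
    simp only [mem_ofPred_eq, ofAdd_add, map_mul, RelIso.mul_apply]
    -- If one summand moves every point to the right, any witness for the other serves. Otherwise
    -- both have fixed points, hence a common one.
    by_cases hv : ∃ x ∈ Ioo a b, ψ (.ofAdd v) x ≤ x
    · by_cases hw : ∃ x ∈ Ioo a b, ψ (.ofAdd w) x ≤ x
      · obtain ⟨x', hx', hvx'⟩ := hv
        obtain ⟨y', hy', hwy'⟩ := hw
        obtain ⟨p, hp, hvp⟩ := OrderIso.exists_fixed_Ioo _ hx hx' hvx hvx'
        obtain ⟨q, hq, hwq⟩ := OrderIso.exists_fixed_Ioo _ hy hy' hwy hwy'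
        obtain ⟨z, hz, h1, h2⟩ := hcomm.exists_common_fixed hp hq hvp hwq
        exact ⟨z, hz, by rw [h2, h1]⟩
      · push Not at hw
        refine ⟨x, hx, hvx.trans ?_⟩
        exact (ψ (.ofAdd v)).monotone (hw x hx).le
    · push Not at hv
      refine ⟨y, hy, (hv y hy).le.trans ?_⟩
      exact (ψ (.ofAdd v)).monotone hwy

variable {ψ : Multiplicative V →* (ℝ ≃o ℝ)} {a b : ℝ}

theorem mem_nonnegOn {hab : a < b} {v : V} :
    v ∈ nonnegOn ψ a b hab ↔ ∃ x ∈ Ioo a b, x ≤ ψ (.ofAdd v) x := Iff.rfl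

/-- Strict positivity of `v` is encoded throughout as `-v ∉ nonnegOn ψ a b hab`. -/
theorem neg_notMem_nonnegOn {hab : a < b} {v : V} :
    -v ∉ nonnegOn ψ a b hab ↔ ∀ x ∈ Ioo a b, x < ψ (.ofAdd v) x := by
  simp only [mem_nonnegOn, not_exists, not_and, not_le, ofAdd_neg, map_inv]
  refine forall₂_congr fun x _ => ?_
  rw [← (ψ (.ofAdd v)).lt_iff_lt, RelIso.apply_inv_self]

theorem mem_or_neg_mem_nonnegOn (hab : a < b) (v : V) :
    v ∈ nonnegOn ψ a b hab ∨ -v ∈ nonnegOn ψ a b hab := by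
  by_contra! h
  obtain ⟨x, hx⟩ := exists_between hab
  have h1 := neg_notMem_nonnegOn.1 h.2 x hx
  exact h.1 ⟨x, hx, h1.le⟩

/-- The archimedean property: otherwise the orbit of `x` under `v` stays below `ψ w x < b`, and its
supremum is a point of the gap that `v` cannot move to the right. -/
theorem IsGap.exists_nsmul_sub_mem (hgap : IsGap ψ a b) {v : V}
    (hv : -v ∉ nonnegOn ψ a b hgap.lt) (w : V) :
    ∃ n : ℕ, n • v - w ∈ nonnegOn ψ a b hgap.lt := by
  by_contra! H
  obtain ⟨x, hx⟩ := exists_between hgap.lt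
  rw [neg_notMem_nonnegOn] at hv
  have hlt : ∀ n : ℕ, (ψ (.ofAdd v) ^ n) x < ψ (.ofAdd w) x := by
    intro n
    have hn : -(w - n • v) ∉ nonnegOn ψ a b hgap.lt := by rw [neg_sub]; exact H n
    have := neg_notMem_nonnegOn.1 hn
    have hmem : (ψ (.ofAdd v) ^ n) x ∈ Ioo a b := by
      have h1 := (ψ (.ofAdd v) ^ n).strictMono hx.1
      have h2 := (ψ (.ofAdd v) ^ n).strictMono hx.2
      rw [← map_pow, hgap.left] at h1
      rw [← map_pow, hgap.right] at h2
      rw [← map_pow]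
      exact ⟨h1, h2⟩
    have := this _ hmem
    rwa [← map_pow, ← RelIso.mul_apply, ← map_mul, ← ofAdd_nsmul, ← ofAdd_add,
      sub_add_cancel, ofAdd_nsmul, map_pow] at this
  have hbdd : BddAbove (range fun n : ℕ => (ψ (.ofAdd v) ^ n) x) :=
    ⟨_, by rintro _ ⟨n, rfl⟩; exact (hlt n).le⟩
  set z := ⨆ n : ℕ, (ψ (.ofAdd v) ^ n) x
  have hxz : x ≤ z := by simpa using le_ciSup hbdd 0
  have hzw : z ≤ ψ (.ofAdd w) x := ciSup_le fun n => (hlt n).le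
  have hwb : ψ (.ofAdd w) x < b := by
    rw [← hgap.right (.ofAdd w)]; exact (ψ (.ofAdd w)).strictMono hx.2
  have hvz := hv z ⟨hx.1.trans_le hxz, hzw.trans_lt hwb⟩
  have : (ψ (.ofAdd v))⁻¹ z < z := by
    rwa [← (ψ (.ofAdd v)).lt_iff_lt, RelIso.apply_inv_self]
  obtain ⟨n, hn⟩ := exists_lt_of_lt_ciSup this
  rw [← (ψ (.ofAdd v)).lt_iff_lt, RelIso.apply_inv_self, ← RelIso.mul_apply, ← pow_succ'] at hn
  exact hn.not_ge (le_ciSup hbdd (n + 1))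

/-- Without positive elements everything has a fixed point in the gap. The two generators then share
one, which is a global fixed point. -/
theorem IsGap.exists_pos {v w : V} (hgap : IsGap ψ a b) (hvw : AddSubgroup.closure {v, w} = ⊤) :
    ∃ u : V, -u ∉ nonnegOn ψ a b hgap.lt := by
  by_contra! H
  have hfix : ∀ u : V, ∃ x ∈ Ioo a b, ψ (.ofAdd u) x = x := by
    intro u
    obtain ⟨x, hx, h1⟩ := mem_nonnegOn.1 (H u)
    have h2 := H (-u)
    rw [neg_neg, mem_nonnegOn] at h2
    obtain ⟨y, hy, h2⟩ := h2
    refine OrderIso.exists_fixed_Ioo _ hy hx h2 ?_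
    rwa [ofAdd_neg, map_inv, ← (ψ (.ofAdd u)).le_iff_le, RelIso.apply_inv_self] at h1
  obtain ⟨x, hx, h1⟩ := hfix v
  obtain ⟨y, hy, h2⟩ := hfix w
  obtain ⟨z, hz, h3, h4⟩ :=
    ((Commute.all (Multiplicative.ofAdd v) (.ofAdd w)).map ψ).exists_common_fixed hx hy h1 h2
  obtain ⟨u, hu⟩ := hgap.exists_ne z hz
  refine hu ?_
  clear hu
  obtain ⟨u, rfl⟩ := Multiplicative.ofAdd.surjective u
  have huc : u ∈ AddSubgroup.closure {v, w} := by rw [hvw]; trivial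
  induction huc using AddSubgroup.closure_induction with
  | mem t ht =>
    rcases ht with rfl | rfl
    exacts [h3, h4]
  | zero => simp
  | add s t _ _ hs ht => rw [ofAdd_add, map_mul, RelIso.mul_apply, ht, hs]
  | neg s _ hs =>
    rw [ofAdd_neg, map_inv]
    nth_rw 1 [← hs]
    exact RelIso.inv_apply_self _ _

/-- A point moved by a fixed element lies in a gap, inside `(0,1)`. -/
theorem exists_isGap (hψ : ∀ v, ∀ x, x ∉ Ioo (0 : ℝ) 1 → ψ v x = x) (h : ψ ≠ 1) :
    ∃ a b, 0 ≤ a ∧ b ≤ 1 ∧ IsGap ψ a b := by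
  obtain ⟨v, hv⟩ := DFunLike.ne_iff.1 h
  obtain ⟨x, hx⟩ := DFunLike.ne_iff.1 hv
  have hx01 : x ∈ Ioo (0 : ℝ) 1 := by
    by_contra hx'
    exact hx (by simpa using hψ v x hx')
  have hcl : IsClosed {z | ∀ w, ψ w z = z} := by
    simp only [ofPred_forall]
    exact isClosed_iInter fun w => isClosed_eq (ψ w).continuous continuous_id
  obtain ⟨a, ⟨⟨ha0, hax⟩, ha⟩, hamax⟩ := (isCompact_Icc (a := 0) (b := x)).inter_right hcl
    |>.exists_isGreatest ⟨0, ⟨le_rfl, hx01.1.le⟩, fun w => hψ w 0 (by simp)⟩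
  obtain ⟨b, ⟨⟨hxb, hb1⟩, hb⟩, hbmin⟩ := (isCompact_Icc (a := x) (b := 1)).inter_right hcl
    |>.exists_isLeast ⟨1, ⟨hx01.2.le, le_rfl⟩, fun w => hψ w 1 (by simp)⟩
  have hxfix : ¬ ∀ w, ψ w x = x := fun hall => hx (by simpa using hall v)
  have hax' : a < x := hax.lt_of_ne (by rintro rfl; exact hxfix ha)
  have hxb' : x < b := hxb.lt_of_ne (by rintro rfl; exact hxfix hb)
  refine ⟨a, b, ha0, hb1, hax'.trans hxb', ha, hb, fun y hy => ?_⟩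
  by_contra! hall
  rcases le_total y x with hyx | hxy
  · exact hy.1.not_ge (hamax ⟨⟨ha0.trans hy.1.le, hyx⟩, hall⟩)
  · exact hy.2.not_ge (hbmin ⟨⟨hxy, hy.2.le.trans hb1⟩, hall⟩)

end AbelianAction

/-! ### Hölder's theorem. -/

section Holder

variable {V : Type*} [AddCommGroup V] {S : AddSubmonoid V}

theorem AddSubmonoid.neg_add_notMem {u w : V} (hu : -u ∉ S)
    (hw : w ∈ S) : -(u + w) ∉ S := by
  intro h
  have := S.add_mem h hw
  exact hu (by rwa [neg_add, add_assoc, neg_add_cancel, add_zero] at this)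

theorem AddSubmonoid.nonneg_of_zsmul_mem (htot : ∀ v, v ∈ S ∨ -v ∈ S) {f : V} (hf : -f ∉ S)
    {k : ℤ} (hk : k • f ∈ S) : 0 ≤ k := by
  by_contra! hneg
  obtain ⟨m, rfl⟩ : ∃ m : ℕ, k = -(m + 1 : ℤ) := ⟨(-k - 1).toNat, by omega⟩
  have hfS : f ∈ S := (htot f).resolve_right hf
  have := S.add_mem hk (S.nsmul_mem hfS m)
  refine hf ?_
  convert this using 1
  rw [neg_smul, add_smul, one_smul, natCast_zsmul]
  abel

/-- **Hölder's theorem** for a total archimedean preorder on an abelian group: monotone additive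
functionals to `ℝ` exist and are unique up to a factor. -/
theorem AddSubmonoid.exists_functional (htot : ∀ v, v ∈ S ∨ -v ∈ S) {f : V} (hf : -f ∉ S)
    (harch : ∀ w, ∃ n : ℕ, n • f - w ∈ S) :
    ∃ τ : V →+ ℝ, τ ≠ 0 ∧ (∀ v ∈ S, 0 ≤ τ v) ∧
      ∀ σ : V →+ ℝ, (∀ v ∈ S, 0 ≤ σ v) → ∃ c : ℝ, ∀ v, σ v = c * τ v := by
  have hfS : f ∈ S := (htot f).resolve_right hf
  -- The fractions `p / q` with `p f ≤ q w` in the preorder; their supremum is the value of the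
  -- functional at `w`.
  let A : V → Set ℝ := fun w =>
    {r | ∃ (p : ℤ) (q : ℕ), 0 < q ∧ r = p / q ∧ q • w - p • f ∈ S}
  have hup : ∀ (w : V) (p : ℤ) (q : ℕ), 0 < q → p • f - q • w ∈ S →
      ∀ r ∈ A w, r ≤ p / q := by
    rintro w p q hq hpq _ ⟨p', q', hq', rfl, hpq'⟩
    have h1 := S.add_mem (S.nsmul_mem hpq' q) (S.nsmul_mem hpq q')
    have h2 : q • (q' • w - p' • f) + q' • (p • f - q • w) = (q' * p - q * p' : ℤ) • f := by
      simp only [← natCast_zsmul]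
      module
    rw [h2] at h1
    have h3 := AddSubmonoid.nonneg_of_zsmul_mem htot hf h1
    rw [div_le_div_iff₀ (by positivity) (by positivity)]
    have h4 : p' * q ≤ p * q' := by linarith
    exact_mod_cast h4
  have hbdd : ∀ w, BddAbove (A w) := by
    intro w
    obtain ⟨n, hn⟩ := harch w
    exact ⟨_, hup w n 1 one_pos (by simpa using hn)⟩
  have hne : ∀ w, (A w).Nonempty := by
    intro w
    obtain ⟨n, hn⟩ := harch (-w)
    refine ⟨_, -n, 1, one_pos, rfl, ?_⟩
    convert hn using 1
    simp [add_comm]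
  let t : V → ℝ := fun w => sSup (A w)
  have lo : ∀ (w : V) (p : ℤ) (q : ℕ), 0 < q → q • w - p • f ∈ S → (p / q : ℝ) ≤ t w :=
    fun w p q hq h => le_csSup (hbdd w) ⟨p, q, hq, rfl, h⟩
  have hi : ∀ (w : V) (p : ℤ) (q : ℕ), 0 < q → p • f - q • w ∈ S → t w ≤ (p / q : ℝ) :=
    fun w p q hq h => csSup_le (hne w) (hup w p q hq h)
  have mem : ∀ (w : V) (r : ℚ), (r : ℝ) < t w → r.den • w - r.num • f ∈ S := by
    intro w r hr
    by_contra h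
    have h' := (htot _).resolve_left h
    rw [neg_sub] at h'
    have := hi w _ _ r.den_pos h'
    rw [← Rat.cast_def] at this
    exact this.not_gt hr
  have neg_le : ∀ w, t (-w) ≤ -t w := by
    intro w
    rw [le_neg]
    refine le_of_forall_rat_lt_imp_le fun r hr => ?_
    have h := hi (-w) (-r.num) r.den r.den_pos (by
      have := mem w r hr
      rwa [neg_smul, smul_neg, sub_neg_eq_add, neg_add_eq_sub])
    rw [le_neg]
    refine h.trans (le_of_eq ?_)
    rw [Rat.cast_def r]
    push_cast
    ring
  have neg_ge : ∀ w, -t w ≤ t (-w) := by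
    intro w
    refine le_of_forall_rat_lt_imp_le fun r hr => ?_
    by_contra! hlt
    have h : r.num • f - r.den • (-w) ∈ S := by
      refine (htot _).resolve_right fun h => hlt.not_ge ?_
      rw [neg_sub] at h
      exact (Rat.cast_def r).le.trans (lo (-w) _ _ r.den_pos h)
    have h' := lo w (-r.num) r.den r.den_pos (by
      rwa [neg_smul, sub_neg_eq_add, add_comm, ← sub_neg_eq_add, ← smul_neg])
    rw [lt_neg] at hr
    refine hr.not_ge (le_trans (le_of_eq ?_) h')
    rw [Rat.cast_def r]
    push_cast
    ring
  have neg_eq : ∀ w, t (-w) = -t w := fun w => (neg_le w).antisymm (neg_ge w)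
  have sup : ∀ v w, t v + t w ≤ t (v + w) := by
    intro v w
    by_contra! h
    obtain ⟨r, hr1, hr2⟩ := exists_rat_btwn (show t (v + w) - t w < t v by linarith)
    obtain ⟨s, hs1, hs2⟩ := exists_rat_btwn (show t (v + w) - r < t w by linarith)
    have h1 := mem v r hr2
    have h2 := mem w s hs2
    have h3 := S.add_mem (S.nsmul_mem h1 s.den) (S.nsmul_mem h2 r.den)
    have h4 := lo (v + w) (s.den * r.num + r.den * s.num) (r.den * s.den)
      (Nat.mul_pos r.den_pos s.den_pos) (by
        convert h3 using 1
        simp only [← natCast_zsmul]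
        push_cast
        module)
    have h5 : (r + s : ℝ) ≤ t (v + w) := by
      refine le_trans (le_of_eq ?_) h4
      have hr0 : (r.den : ℝ) ≠ 0 := by exact_mod_cast r.den_pos.ne'
      have hs0 : (s.den : ℝ) ≠ 0 := by exact_mod_cast s.den_pos.ne'
      rw [Rat.cast_def r, Rat.cast_def s]
      push_cast
      field_simp
    linarith
  let τ : V →+ ℝ := AddMonoidHom.mk' t fun v w => le_antisymm (by
    have := sup (-v) (-w)
    rw [← neg_add, neg_eq, neg_eq, neg_eq] at this
    linarith) (sup v w)
  have hτf : 1 ≤ τ f := by simpa [τ] using lo f 1 1 one_pos (by simp)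
  refine ⟨τ, ?_, fun v hv => by simpa [τ] using lo v 0 1 one_pos (by simpa), fun σ hσ => ?_⟩
  · intro h
    rw [h, AddMonoidHom.zero_apply] at hτf
    linarith
  -- Applying this inequality to `v` and to `-v` gives equality, with factor `σ f`.
  have key : ∀ w, σ f * τ w ≤ σ w := by
    intro w
    have hr : ∀ r : ℚ, (r : ℝ) < τ w → r * σ f ≤ σ w := by
      intro r hr
      have := hσ _ (mem w r hr)
      rw [map_sub, map_nsmul, map_zsmul, nsmul_eq_mul, zsmul_eq_mul, sub_nonneg] at this
      rwa [Rat.cast_def r, div_mul_eq_mul_div, div_le_iff₀ (by exact_mod_cast r.den_pos),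
        mul_comm (σ w)]
    rcases (hσ f hfS).eq_or_lt with h0 | h0
    · obtain ⟨r, hr'⟩ := exists_rat_lt (τ w)
      have := hr r hr'
      rw [← h0] at this ⊢
      linarith
    · rw [mul_comm, ← le_div_iff₀ h0]
      exact le_of_forall_rat_lt_imp_le fun r h => (le_div_iff₀ h0).2 (hr r h)
  refine ⟨σ f, fun v => le_antisymm ?_ (key v)⟩
  have := key (-v)
  rw [map_neg, map_neg] at this
  linarith

end Holder

/-! ### Elements normalizing the abelian action. -/

section Normalizer

variable {V : Type*} [AddCommGroup V] {ψ : Multiplicative V →* (ℝ ≃o ℝ)} {a b : ℝ}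
  {g : ℝ ≃o ℝ} {D E : V →+ V}

theorem IsGap.mem_nonnegOn_of_fixed (hgap : IsGap ψ a b)
    (hD : ∀ v, ψ (.ofAdd v) * g = g * ψ (.ofAdd (D v))) (ha : g a = a) (hb : g b = b) {v : V}
    (hv : D v ∈ nonnegOn ψ a b hgap.lt) : v ∈ nonnegOn ψ a b hgap.lt := by
  obtain ⟨x, hx, h⟩ := mem_nonnegOn.1 hv
  have h1 := g.strictMono hx.1
  have h2 := g.strictMono hx.2
  rw [ha] at h1
  rw [hb] at h2
  refine ⟨g x, ⟨h1, h2⟩, ?_⟩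
  rw [← RelIso.mul_apply, hD, RelIso.mul_apply]
  exact g.monotone h

theorem IsGap.apply_notMem_Ioo (hgap : IsGap ψ a b)
    (hD : ∀ v, ψ (.ofAdd v) * g = g * ψ (.ofAdd (D v))) {x : ℝ} (hx : ∀ v, ψ v x = x) :
    g x ∉ Ioo a b := by
  intro h
  obtain ⟨v, hv⟩ := hgap.exists_ne _ h
  refine hv ?_
  obtain ⟨v, rfl⟩ := Multiplicative.ofAdd.surjective v
  rw [← RelIso.mul_apply, hD, RelIso.mul_apply, hx]

/-- `g` and `g⁻¹` carry global fixed points to global fixed points, so endpoints never land inside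
the gap. -/
theorem IsGap.disjoint_of_ne (hgap : IsGap ψ a b)
    (hD : ∀ v, ψ (.ofAdd v) * g = g * ψ (.ofAdd (D v)))
    (hE : ∀ v, ψ (.ofAdd v) * g⁻¹ = g⁻¹ * ψ (.ofAdd (E v))) (hne : g a ≠ a) :
    b ≤ g a ∨ g b ≤ a := by
  rcases hne.lt_or_gt with h | h
  · right
    have h' : a < g⁻¹ a := by rwa [← g.lt_iff_lt, RelIso.apply_inv_self]
    have := hgap.apply_notMem_Ioo hE hgap.left
    have hb : b ≤ g⁻¹ a := by
      by_contra! hlt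
      exact this ⟨h', hlt⟩
    rwa [← g.le_iff_le, RelIso.apply_inv_self] at hb
  · left
    by_contra! hlt
    exact hgap.apply_notMem_Ioo hD hgap.left ⟨h, hlt⟩

theorem IsGap.apply_right (hgap : IsGap ψ a b)
    (hD : ∀ v, ψ (.ofAdd v) * g = g * ψ (.ofAdd (D v)))
    (hE : ∀ v, ψ (.ofAdd v) * g⁻¹ = g⁻¹ * ψ (.ofAdd (E v))) (ha : g a = a) : g b = b := by
  have ha' : g⁻¹ a = a := by nth_rw 1 [← ha]; exact RelIso.inv_apply_self g a
  have h1 : b ≤ g b := by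
    by_contra! hlt
    exact hgap.apply_notMem_Ioo hD hgap.right ⟨by
      nth_rw 1 [← ha]; exact g.strictMono hgap.lt, hlt⟩
  have h2 : b ≤ g⁻¹ b := by
    by_contra! hlt
    exact hgap.apply_notMem_Ioo hE hgap.right ⟨by
      nth_rw 1 [← ha']; exact g⁻¹.strictMono hgap.lt, hlt⟩
  rw [← g.le_iff_le, RelIso.apply_inv_self] at h2
  exact h2.antisymm h1

/-- On `gⁿ(a,b)` the map `ψ v` is conjugate to `D^[n] v` on `(a,b)`. The relation `hT`, which is
Cayley–Hamilton, propagates `D v > 2 v` along the orbit. -/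
theorem IsGap.false_of_expanding (hgap : IsGap ψ a b) (ha : 0 ≤ a) (hb : b ≤ 1)
    (hψ : ∀ v, IsIntervalDiffeo (ψ v)) (hg : IsIntervalDiffeo g)
    (hD : ∀ v, ψ (.ofAdd v) * g = g * ψ (.ofAdd (D v))) {T : ℕ} (hT3 : 3 ≤ T)
    (hT : ∀ v, D (D v) + v = T • D v) {v : V} (hv : -v ∉ nonnegOn ψ a b hgap.lt)
    (hDv : -(D v - 2 • v) ∉ nonnegOn ψ a b hgap.lt) (hdisj : b ≤ g a ∨ g b ≤ a) : False := by
  have htot := mem_or_neg_mem_nonnegOn (ψ := ψ) hgap.lt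
  have hpos : ∀ {u}, -u ∉ nonnegOn ψ a b hgap.lt → u ∈ nonnegOn ψ a b hgap.lt :=
    fun h => (htot _).resolve_right h
  have horb : ∀ n : ℕ, -(D^[n] v) ∉ nonnegOn ψ a b hgap.lt ∧
      -(D (D^[n] v) - 2 • D^[n] v) ∉ nonnegOn ψ a b hgap.lt := by
    intro n
    induction n with
    | zero => exact ⟨hv, hDv⟩
    | succ n ih =>
      rw [Function.iterate_succ_apply']
      obtain ⟨h1, h2⟩ := ih
      generalize D^[n] v = w at *
      have h3 : -(D w) ∉ nonnegOn ψ a b hgap.lt := by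
        have := AddSubmonoid.neg_add_notMem h2 ((nonnegOn ψ a b hgap.lt).nsmul_mem (hpos h1) 2)
        rwa [sub_add_cancel] at this
      refine ⟨h3, ?_⟩
      -- With `T = m + 3`, `D² w - 2 D w = (D w - 2 w) + w + m D w`.
      obtain ⟨m, rfl⟩ := Nat.exists_eq_add_of_le' hT3
      have := AddSubmonoid.neg_add_notMem h2
        ((nonnegOn ψ a b hgap.lt).add_mem (hpos h1)
          ((nonnegOn ψ a b hgap.lt).nsmul_mem (hpos h3) m))
      have hw := eq_sub_of_add_eq (hT w)
      rw [hw]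
      convert this using 2
      module
  have hpow : ∀ (n : ℕ) (u : V), ψ (.ofAdd u) * g ^ n = g ^ n * ψ (.ofAdd (D^[n] u)) := by
    intro n
    induction n with
    | zero => simp
    | succ n ih =>
      intro u
      rw [pow_succ, ← mul_assoc, ih, mul_assoc, hD, ← mul_assoc, Function.iterate_succ_apply']
  have happ : ∀ (n : ℕ) (u : V) (x : ℝ),
      ψ (.ofAdd u) ((g ^ n) x) = (g ^ n) (ψ (.ofAdd (D^[n] u)) x) := fun n u x => by
    rw [← RelIso.mul_apply, hpow, RelIso.mul_apply]
  have hmap : ∀ (u : V), ∀ x ∈ Ioo a b, ψ (.ofAdd u) x ∈ Ioo a b := fun u x hx => by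
    have h1 := (ψ (.ofAdd u)).strictMono hx.1
    have h2 := (ψ (.ofAdd u)).strictMono hx.2
    rw [hgap.left] at h1
    rw [hgap.right] at h2
    exact ⟨h1, h2⟩
  refine hg.false_of_expanding (hψ (.ofAdd v)) ha hgap.lt hb hdisj
    (fun n => by rw [happ, hgap.left]) (fun n => by rw [happ, hgap.right]) (fun n x hx => ?_)
    fun n x hx => ?_
  · rw [happ]
    exact (g ^ n).strictMono (neg_notMem_nonnegOn.1 (horb n).1 x hx)
  · rw [happ, happ, happ, ← RelIso.mul_apply g, ← pow_succ']
    refine (g ^ (n + 1)).strictMono ?_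
    rw [Function.iterate_succ_apply']
    obtain ⟨h1, h2⟩ := horb n
    generalize D^[n] v = w at *
    rw [neg_notMem_nonnegOn] at h1 h2
    have hy := hmap w x hx
    have hz := h2 _ (hmap w _ hy)
    have hw : Multiplicative.ofAdd (D w) = .ofAdd (D w - 2 • w) * (.ofAdd w * .ofAdd w) := by
      rw [← ofAdd_add, ← ofAdd_add]
      congr 1
      module
    rwa [hw, map_mul, map_mul]

/-- A hyperbolic element of the normalizer fixes every gap of the abelian group. -/
theorem IsGap.apply_left_of_hyperbolic (hgap : IsGap ψ a b) (ha : 0 ≤ a) (hb : b ≤ 1)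
    (hψ : ∀ v, IsIntervalDiffeo (ψ v)) (hg : IsIntervalDiffeo g) (hg' : IsIntervalDiffeo g⁻¹)
    (hD : ∀ v, ψ (.ofAdd v) * g = g * ψ (.ofAdd (D v)))
    (hE : ∀ v, ψ (.ofAdd v) * g⁻¹ = g⁻¹ * ψ (.ofAdd (E v)))
    (hDE : ∀ v, D (E v) = v) (hED : ∀ v, E (D v) = v) {T : ℕ} (hT5 : 5 ≤ T)
    (hT : ∀ v, D v + E v = T • v) {v : V} (hv : -v ∉ nonnegOn ψ a b hgap.lt) : g a = a := by
  have htot := mem_or_neg_mem_nonnegOn (ψ := ψ) hgap.lt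
  by_contra hne
  have hne' : g⁻¹ a ≠ a := fun h => hne (by
    nth_rw 1 [← h]; exact RelIso.apply_inv_self g a)
  -- If neither `D v > 2 v` nor `E v > 2 v`, then `T v ≤ 4 v`, impossible for positive `v` and `T ≥
  -- 5`.
  by_cases h1 : -(D v - 2 • v) ∈ nonnegOn ψ a b hgap.lt
  · by_cases h2 : -(E v - 2 • v) ∈ nonnegOn ψ a b hgap.lt
    · obtain ⟨m, rfl⟩ := Nat.exists_eq_add_of_le' hT5
      refine hv ?_
      have h3 := add_mem (add_mem h1 h2)
        ((nonnegOn ψ a b hgap.lt).nsmul_mem ((htot v).resolve_right hv) m)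
      have hE' := eq_sub_of_add_eq' (hT v)
      convert h3 using 1
      rw [hE']
      module
    · exact hgap.false_of_expanding ha hb hψ hg' hE (T := T) (by omega)
        (fun w => by rw [← hT (E w), hDE, add_comm]) hv h2
        (hgap.disjoint_of_ne hE (by rwa [inv_inv]) hne')
  · exact hgap.false_of_expanding ha hb hψ hg hD (T := T) (by omega)
      (fun w => by rw [← hT (D w), hED]) hv h1 (hgap.disjoint_of_ne hD hE hne)

end Normalizer

/-! ### Traces and solvability criteria in `SL(2, ℤ)`. -/

theorem trace_mul_add_trace_inv_mul (A B : SL(2, ℤ)) :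
    ((A * B) 0 0 + (A * B) 1 1) + ((A⁻¹ * B) 0 0 + (A⁻¹ * B) 1 1) =
      (A 0 0 + A 1 1) * (B 0 0 + B 1 1) := by
  simp only [Matrix.SpecialLinearGroup.coe_mul, Matrix.SpecialLinearGroup.coe_inv, Matrix.adjugate_fin_two, Matrix.mul_apply,
    Fin.sum_univ_two, Matrix.of_apply, Matrix.cons_val', Matrix.cons_val_zero,
    Matrix.cons_val_one, Matrix.cons_val_fin_one]
  ring

theorem trace_sq (A : SL(2, ℤ)) :
    (A ^ 2) 0 0 + (A ^ 2) 1 1 = (A 0 0 + A 1 1) ^ 2 - 2 := by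
  have h := A.det_coe
  rw [Matrix.det_fin_two] at h
  simp only [pow_two, Matrix.SpecialLinearGroup.coe_mul, Matrix.mul_apply, Fin.sum_univ_two]
  linear_combination -2 * h

/-- The entries of a real matrix of determinant one fixing the row vector `(s,t)`. -/
theorem row_fixed_entries {s t : ℝ} (hst : s ≠ 0 ∨ t ≠ 0) {p q r u : ℝ} (h1 : s * p + t * r = s)
    (h2 : s * q + t * u = t) (hdet : p * u - q * r = 1) :
    (s ≠ 0 → p = 1 - t / s * r ∧ q = -(t / s) ^ 2 * r ∧ u = 1 + t / s * r) ∧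
      (t ≠ 0 → p = 1 + s / t * q ∧ r = -(s / t) ^ 2 * q ∧ u = 1 - s / t * q) := by
  -- Eigenvalue 1 and determinant 1 force trace 2.
  have hs : s * (p + u - 2) = 0 := by linear_combination h1 + s * hdet - u * h1 + r * h2
  have ht : t * (p + u - 2) = 0 := by linear_combination h2 + t * hdet - p * h2 + q * h1
  have htr : p + u - 2 = 0 :=
    hst.elim (fun h => (mul_eq_zero.1 hs).resolve_left h) fun h => (mul_eq_zero.1 ht).resolve_left h
  refine ⟨fun h => ?_, fun h => ?_⟩
  · have hp : p = 1 - t / s * r := by field_simp; linarith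
    have hu : u = 1 + t / s * r := by linarith
    refine ⟨hp, ?_, hu⟩
    have : q = t / s * (1 - u) := by field_simp; linarith
    rw [this, hu]; ring
  · have hu : u = 1 - s / t * q := by field_simp; linarith
    have hp : p = 1 + s / t * q := by linarith
    refine ⟨hp, ?_, hu⟩
    have : r = s / t * (1 - p) := by field_simp; linarith
    rw [this, hp]; ring

/-- Subgroups of `SL₂(ℤ)` with a common real row eigenvector are solvable. -/
theorem isSolvable_of_row_eigenvector (Δ : Subgroup SL(2, ℤ)) {s t : ℝ} (hst : s ≠ 0 ∨ t ≠ 0)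
    (h : ∀ B ∈ Δ, ∃ c : ℝ, s * B 0 0 + t * B 1 0 = c * s ∧ s * B 0 1 + t * B 1 1 = c * t) :
    Group.IsSolvable Δ := by
  choose c hc using fun B : Δ => h B B.2
  have huniq : ∀ {x y : ℝ}, x * s = y * s → x * t = y * t → x = y := fun h1 h2 =>
    hst.elim (fun h => mul_right_cancel₀ h h1) fun h => mul_right_cancel₀ h h2
  let χ : Δ →* ℝ :=
    { toFun := c
      map_one' := by
        obtain ⟨h1, h2⟩ := hc 1
        simp only [OneMemClass.coe_one, Matrix.SpecialLinearGroup.coe_one, Matrix.one_apply] at h1 h2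
        norm_num at h1 h2
        exact huniq (by linarith) (by linarith)
      map_mul' := fun A B => by
        obtain ⟨h1, h2⟩ := hc (A * B)
        obtain ⟨h3, h4⟩ := hc A
        obtain ⟨h5, h6⟩ := hc B
        simp only [Subgroup.coe_mul, Matrix.SpecialLinearGroup.coe_mul, Matrix.mul_apply,
          Fin.sum_univ_two, Int.cast_add, Int.cast_mul] at h1 h2
        refine huniq ?_ ?_
        · linear_combination -h1 + c A * h5 + (B : SL(2, ℤ)) 0 0 * h3 + (B : SL(2, ℤ)) 1 0 * h4
        · linear_combination -h2 + c A * h6 + (B : SL(2, ℤ)) 0 1 * h3 + (B : SL(2, ℤ)) 1 1 * h4 }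
  -- Matrices with eigenvalue 1 on `(s,t)` have the form `1 + r M` for one fixed `M`, hence commute.
  have hker : ∀ A B : χ.toHomUnits.ker, A * B = B * A := by
    have hone : ∀ A : χ.toHomUnits.ker, c A = 1 := fun A => congrArg Units.val A.2
    intro A B
    obtain ⟨h1, h2⟩ := hc A
    obtain ⟨h3, h4⟩ := hc B
    rw [hone, one_mul] at h1 h2 h3 h4
    have hA := ((A : Δ) : SL(2, ℤ)).det_coe
    have hB := ((B : Δ) : SL(2, ℤ)).det_coe
    rw [Matrix.det_fin_two] at hA hB
    have hA' := row_fixed_entries hst h1 h2 (by exact_mod_cast hA)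
    have hB' := row_fixed_entries hst h3 h4 (by exact_mod_cast hB)
    refine Subtype.ext (Subtype.ext (Subtype.ext (Matrix.map_injective Int.cast_injective
      (β := ℝ) ?_)))
    simp only [Subgroup.coe_mul, Matrix.SpecialLinearGroup.coe_mul]
    ext i j
    rcases hst with hs | ht
    · obtain ⟨a1, a2, a3⟩ := hA'.1 hs
      obtain ⟨b1, b2, b3⟩ := hB'.1 hs
      fin_cases i <;> fin_cases j <;> simp [Matrix.mul_apply, a1, a2, a3, b1, b2, b3] <;> ring
    · obtain ⟨a1, a2, a3⟩ := hA'.2 ht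
      obtain ⟨b1, b2, b3⟩ := hB'.2 ht
      fin_cases i <;> fin_cases j <;> simp [Matrix.mul_apply, a1, a2, a3, b1, b2, b3] <;> ring
  have : Group.IsSolvable χ.toHomUnits.ker := Group.isSolvable_of_comm hker
  exact Group.isSolvable_of_ker_le_range χ.toHomUnits.ker.subtype χ.toHomUnits (by simp)

theorem exists_row_eigenvalue {s t : ℝ} (hst : s ≠ 0 ∨ t ≠ 0) {x y : ℝ} (h : s * y = t * x) :
    ∃ c : ℝ, x = c * s ∧ y = c * t := by
  rcases hst with h0 | h0
  · refine ⟨x / s, by field_simp, ?_⟩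
    field_simp
    linarith
  · refine ⟨y / t, ?_, by field_simp⟩
    field_simp
    linarith

theorem isSolvable_of_trace_sq_eq_four (Δ : Subgroup SL(2, ℤ))
    (h : ∀ A ∈ Δ, A 0 0 + A 1 1 = 2 ∨ A 0 0 + A 1 1 = -2) : Group.IsSolvable Δ := by
  by_cases hcen : ∀ A ∈ Δ, A 0 1 = 0 ∧ A 1 0 = 0 ∧ A 0 0 = A 1 1
  · refine Group.isSolvable_of_comm fun A B => Subtype.ext (Subtype.ext ?_)
    obtain ⟨h1, h2, h3⟩ := hcen A A.2
    simp only [Subgroup.coe_mul, Matrix.SpecialLinearGroup.coe_mul]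
    ext i j
    fin_cases i <;> fin_cases j <;> simp [Matrix.mul_apply, Fin.sum_univ_two, h1, h2, h3, mul_comm]
  push Not at hcen
  obtain ⟨A, hA, hne⟩ := hcen
  have hdet := A.det_coe
  rw [Matrix.det_fin_two] at hdet
  -- `tr(AB)` and `tr(A⁻¹B)` are each ±2 with sum ±4, so they are equal. Thus the traceless part `N`
  -- of `A` satisfies `tr(NB) = 0`. By `hdisc`, `N` is nilpotent of rank one, so `B` preserves its
  -- row space, spanned by whichever row of `N` is nonzero.
  have hzero : ∀ B ∈ Δ, (A 0 0 - A 1 1) * (B 0 0 - B 1 1) + 2 * A 0 1 * B 1 0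
      + 2 * A 1 0 * B 0 1 = 0 := by
    intro B hB
    have h1 := h _ (Δ.mul_mem hA hB)
    have h2 := h _ (Δ.mul_mem (Δ.inv_mem hA) hB)
    have h3 := h _ hA
    have h4 := h _ hB
    have h5 := trace_mul_add_trace_inv_mul A B
    have h6 : (A 0 0 - A 1 1) * (B 0 0 - B 1 1) + 2 * A 0 1 * B 1 0 + 2 * A 1 0 * B 0 1 =
        ((A * B) 0 0 + (A * B) 1 1) - ((A⁻¹ * B) 0 0 + (A⁻¹ * B) 1 1) := by
      simp only [Matrix.SpecialLinearGroup.coe_mul, Matrix.SpecialLinearGroup.coe_inv, Matrix.adjugate_fin_two, Matrix.mul_apply,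
        Fin.sum_univ_two, Matrix.of_apply, Matrix.cons_val', Matrix.cons_val_zero,
        Matrix.cons_val_one, Matrix.cons_val_fin_one]
      ring
    rw [h6]
    rcases h3 with h3 | h3 <;> rcases h4 with h4 | h4 <;> rw [h3, h4] at h5 <;> omega
  have hdisc : (A 0 0 - A 1 1) ^ 2 + 4 * A 0 1 * A 1 0 = 0 := by
    have : (A 0 0 + A 1 1) ^ 2 = 4 := by rcases h A hA with h | h <;> rw [h] <;> norm_num
    linear_combination this - 4 * hdet
  by_cases hq : A 0 0 - A 1 1 = 0 ∧ A 0 1 = 0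
  · obtain ⟨hp, hq⟩ := hq
    have hr : A 1 0 ≠ 0 := fun h0 => hne hq h0 (sub_eq_zero.1 hp)
    refine isSolvable_of_row_eigenvector Δ (s := 1) (t := 0) (Or.inl one_ne_zero) fun B hB =>
      exists_row_eigenvalue (Or.inl one_ne_zero) ?_
    have := hzero B hB
    rw [hp, hq] at this
    have : B 0 1 = 0 := by
      have : A 1 0 * B 0 1 = 0 := by linarith
      exact (mul_eq_zero.1 this).resolve_left hr
    simp [this]
  · have hst : ((A 0 0 - A 1 1 : ℤ) : ℝ) ≠ 0 ∨ ((2 * A 0 1 : ℤ) : ℝ) ≠ 0 := by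
      rw [Int.cast_ne_zero, Int.cast_ne_zero]
      by_contra! h0
      exact hq ⟨h0.1, by linarith [h0.2]⟩
    refine isSolvable_of_row_eigenvector Δ hst fun B hB => exists_row_eigenvalue hst ?_
    have hB' := hzero B hB
    norm_cast
    linear_combination (B 0 1) * hdisc - 2 * A 0 1 * hB'

/-! ### The action of a matrix group and its lattice on the interval. -/

/-- The multiplication by an integer matrix, as an additive map. -/
def mulVecHom (A : SL(2, ℤ)) : (Fin 2 → ℤ) →+ (Fin 2 → ℤ) := (Matrix.mulVecLin A.1).toAddMonoidHom

theorem mulVecHom_apply (A : SL(2, ℤ)) (v : Fin 2 → ℤ) : mulVecHom A v = A.1 *ᵥ v := rfl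

theorem mulVecHom_mul_apply (A B : SL(2, ℤ)) (v : Fin 2 → ℤ) :
    mulVecHom A (mulVecHom B v) = mulVecHom (A * B) v := by
  rw [mulVecHom_apply, mulVecHom_apply, mulVecHom_apply, Matrix.mulVec_mulVec,
    Matrix.SpecialLinearGroup.coe_mul]

theorem mulVecHom_one (v : Fin 2 → ℤ) : mulVecHom 1 v = v := by
  simp [mulVecHom_apply]

theorem mulVecHom_add_inv (A : SL(2, ℤ)) (v : Fin 2 → ℤ) :
    mulVecHom A v + mulVecHom A⁻¹ v = (A 0 0 + A 1 1) • v := by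
  rw [mulVecHom_apply, mulVecHom_apply, Matrix.SpecialLinearGroup.coe_inv,
    Matrix.adjugate_fin_two]
  ext i
  fin_cases i <;> simp [dotProduct, Fin.sum_univ_two] <;> ring

section Action

variable {Δ : Subgroup SL(2, ℤ)} {ψ : Multiplicative (Fin 2 → ℤ) →* (ℝ ≃o ℝ)}
  {θ : Δ →* (ℝ ≃o ℝ)} {a b : ℝ}

theorem semiconj_mulVecHom_inv
    (hconj : ∀ A v, θ A * ψ (.ofAdd v) * (θ A)⁻¹ = ψ (.ofAdd (mulVecHom A v))) (A : Δ)
    (v : Fin 2 → ℤ) :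
    ψ (.ofAdd v) * θ A = θ A * ψ (.ofAdd (mulVecHom (A : SL(2, ℤ))⁻¹ v)) := by
  have := hconj A (mulVecHom (A : SL(2, ℤ))⁻¹ v)
  rw [mulVecHom_mul_apply, mul_inv_cancel, mulVecHom_one] at this
  rw [← this]
  group

theorem apply_left_of_abs_trace (hψ : ∀ v, IsIntervalDiffeo (ψ v))
    (hθ : ∀ A, IsIntervalDiffeo (θ A))
    (hconj : ∀ A v, θ A * ψ (.ofAdd v) * (θ A)⁻¹ = ψ (.ofAdd (mulVecHom A v)))
    (hgap : IsGap ψ a b) (ha : 0 ≤ a) (hb : b ≤ 1) {v : Fin 2 → ℤ}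
    (hv : -v ∉ nonnegOn ψ a b hgap.lt) (A : Δ)
    (hA : 5 ≤ |(A : SL(2, ℤ)) 0 0 + (A : SL(2, ℤ)) 1 1|) : θ A a = a := by
  have key : ∀ A : Δ, 5 ≤ (A : SL(2, ℤ)) 0 0 + (A : SL(2, ℤ)) 1 1 → θ A a = a := by
    intro A hA
    have h1 := semiconj_mulVecHom_inv hconj A
    have h2 := semiconj_mulVecHom_inv hconj A⁻¹
    rw [InvMemClass.coe_inv, inv_inv, map_inv] at h2
    obtain ⟨T, hT⟩ := Int.eq_ofNat_of_zero_le (show 0 ≤ (A : SL(2, ℤ)) 0 0 + (A : SL(2, ℤ)) 1 1 by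
      omega)
    refine hgap.apply_left_of_hyperbolic ha hb hψ (hθ A) (by rw [← map_inv]; exact hθ _) h1 h2
      (fun v => ?_) (fun v => ?_) (T := T) (by omega) (fun v => ?_) hv
    · rw [mulVecHom_mul_apply, inv_mul_cancel, mulVecHom_one]
    · rw [mulVecHom_mul_apply, mul_inv_cancel, mulVecHom_one]
    · rw [add_comm, mulVecHom_add_inv, hT, natCast_zsmul]
  -- Squaring makes a negative trace positive, and a monotone map whose square fixes `a` fixes `a`.
  have h2 := key (A ^ 2) (by
    rw [SubmonoidClass.coe_pow, trace_sq]
    have := sq_abs ((A : SL(2, ℤ)) 0 0 + (A : SL(2, ℤ)) 1 1)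
    nlinarith)
  rw [map_pow, pow_two, RelIso.mul_apply] at h2
  rcases lt_trichotomy (θ A a) a with h | h | h
  · exact absurd h2 (((θ A).strictMono h).trans h).ne
  · exact h
  · exact absurd h2 (h.trans ((θ A).strictMono h)).ne'

theorem isSolvable_of_action (hψ : ∀ v, IsIntervalDiffeo (ψ v))
    (hθ : ∀ A, IsIntervalDiffeo (θ A))
    (hconj : ∀ A v, θ A * ψ (.ofAdd v) * (θ A)⁻¹ = ψ (.ofAdd (mulVecHom A v)))
    (hne : ψ ≠ 1) (htr : ∀ A ∈ Δ, ∃ k, A 0 0 + A 1 1 = 4 * k + 2) : Group.IsSolvable Δ := by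
  by_cases hhyp : ∀ A ∈ Δ, |A 0 0 + A 1 1| < 5
  · refine isSolvable_of_trace_sq_eq_four Δ fun A hA => ?_
    obtain ⟨k, hk⟩ := htr A hA
    have := abs_lt.1 (hhyp A hA)
    omega
  push Not at hhyp
  obtain ⟨A, hA, hA5⟩ := hhyp
  obtain ⟨a, b, ha, hb, hgap⟩ := exists_isGap (fun v => (hψ v).eq_self) hne
  have hgen : AddSubgroup.closure {![1, 0], ![0, 1]} = (⊤ : AddSubgroup (Fin 2 → ℤ)) := by
    rw [eq_top_iff]
    intro v _
    have : v = v 0 • ![1, 0] + v 1 • ![0, 1] := by ext i; fin_cases i <;> simp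
    rw [this]
    exact add_mem (zsmul_mem (AddSubgroup.subset_closure (by simp)) _)
      (zsmul_mem (AddSubgroup.subset_closure (by simp)) _)
  obtain ⟨v, hv⟩ := hgap.exists_pos hgen
  have hstab := apply_left_of_abs_trace hψ hθ hconj hgap ha hb hv
  lift A to Δ using hA
  -- `|tr A · tr B| ≥ 10`, so `A * B` or `A⁻¹ * B` has absolute trace at least 5 and fixes `a`, as
  -- `A` does.
  have hall : ∀ B : Δ, θ B a = a := by
    intro B
    have hsum := trace_mul_add_trace_inv_mul A B
    rw [← InvMemClass.coe_inv, ← Subgroup.coe_mul, ← Subgroup.coe_mul] at hsum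
    have hB2 : 2 ≤ |(B : SL(2, ℤ)) 0 0 + (B : SL(2, ℤ)) 1 1| := by
      obtain ⟨k, hk⟩ := htr B B.2
      rw [hk, le_abs]
      omega
    have h10 := abs_add_le (((A * B : Δ) : SL(2, ℤ)) 0 0 + ((A * B : Δ) : SL(2, ℤ)) 1 1)
      (((A⁻¹ * B : Δ) : SL(2, ℤ)) 0 0 + ((A⁻¹ * B : Δ) : SL(2, ℤ)) 1 1)
    rw [hsum, abs_mul] at h10
    have h10' := (mul_le_mul hA5 hB2 (by norm_num) (abs_nonneg _)).trans h10
    have hAa := hstab A hA5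
    rcases le_or_gt 5 |((A * B : Δ) : SL(2, ℤ)) 0 0 + ((A * B : Δ) : SL(2, ℤ)) 1 1| with h | h
    · have := hstab (A * B) h
      rw [map_mul, RelIso.mul_apply] at this
      exact (θ A).injective (this.trans hAa.symm)
    · have := hstab (A⁻¹ * B) (by linarith)
      rw [map_mul, map_inv, RelIso.mul_apply] at this
      have h' := congrArg (θ A) this
      rwa [RelIso.apply_inv_self, hAa] at h'
  obtain ⟨τ, hτ0, hτS, hτu⟩ := AddSubmonoid.exists_functional
    (mem_or_neg_mem_nonnegOn (ψ := ψ) hgap.lt) hv (hgap.exists_nsmul_sub_mem hv)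
  have hτ : ∀ w, τ w = τ ![1, 0] * w 0 + τ ![0, 1] * w 1 := by
    intro w
    have : w = w 0 • ![1, 0] + w 1 • ![0, 1] := by ext i; fin_cases i <;> simp
    conv_lhs => rw [this]
    rw [map_add, map_zsmul, map_zsmul, zsmul_eq_mul, zsmul_eq_mul, mul_comm, mul_comm (w 1 : ℝ)]
  refine isSolvable_of_row_eigenvector Δ (s := τ ![1, 0]) (t := τ ![0, 1]) ?_ fun B hB => ?_
  · by_contra! h
    refine hτ0 (AddMonoidHom.ext fun w => ?_)
    rw [hτ, h.1, h.2]
    simp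
  -- `B` preserves the preorder, so `τ ∘ B` is again monotone; uniqueness makes `τ` an eigenvector.
  · obtain ⟨c, hc⟩ := hτu (τ.comp (mulVecHom B)) fun w hw => hτS _ (by
      have h1 := semiconj_mulVecHom_inv hconj ⟨B, hB⟩
      have h2 := semiconj_mulVecHom_inv hconj ⟨B, hB⟩⁻¹
      rw [InvMemClass.coe_inv, inv_inv, map_inv] at h2
      refine hgap.mem_nonnegOn_of_fixed h1 (hall _) (hgap.apply_right h1 h2 (hall _)) ?_
      rwa [mulVecHom_mul_apply, inv_mul_cancel, mulVecHom_one])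
    refine ⟨c, ?_, ?_⟩
    · rw [← hc ![1, 0], AddMonoidHom.comp_apply, hτ (mulVecHom B _)]
      simp [mulVecHom_apply, Matrix.mulVec, dotProduct, Fin.sum_univ_two]
    · rw [← hc ![0, 1], AddMonoidHom.comp_apply, hτ (mulVecHom B _)]
      simp [mulVecHom_apply, Matrix.mulVec, dotProduct, Fin.sum_univ_two]

end Action

/-! ### Extending diffeomorphisms of `[0,1]` to `ℝ`. -/

theorem Diff1Plus.strictMono_ofSubtype (f : Diff1Plus) [DecidablePred (· ∈ Icc (0 : ℝ) 1)] :
    StrictMono (Equiv.Perm.ofSubtype f.1 : Equiv.Perm ℝ) := by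
  intro x y hxy
  have hmem : ∀ z (hz : z ∈ Icc (0 : ℝ) 1), Equiv.Perm.ofSubtype f.1 z = (f.1 ⟨z, hz⟩ : ℝ) :=
    fun z hz => Equiv.Perm.ofSubtype_apply_of_mem f.1 hz
  have hnot : ∀ z, z ∉ Icc (0 : ℝ) 1 → Equiv.Perm.ofSubtype f.1 z = z :=
    fun z hz => Equiv.Perm.ofSubtype_apply_of_not_mem f.1 hz
  by_cases hx : x ∈ Icc (0 : ℝ) 1 <;> by_cases hy : y ∈ Icc (0 : ℝ) 1
  · rw [hmem x hx, hmem y hy]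
    exact f.2.1 (show (⟨x, hx⟩ : Icc (0 : ℝ) 1) < ⟨y, hy⟩ from hxy)
  · rw [hmem x hx, hnot y hy]
    by_contra! h
    exact hy ⟨hx.1.trans hxy.le, h.trans (f.1 _).2.2⟩
  · rw [hmem y hy, hnot x hx]
    by_contra! h
    exact hx ⟨(f.1 _).2.1.trans h, hxy.le.trans hy.2⟩
  · rwa [hnot x hx, hnot y hy]

open Classical in
/-- The extension of diffeomorphisms of `[0,1]` to `ℝ` by the identity. -/
noncomputable def Diff1Plus.extend : Diff1Plus →* (ℝ ≃o ℝ) where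
  toFun f := ⟨Equiv.Perm.ofSubtype f.1, (Diff1Plus.strictMono_ofSubtype f).le_iff_le⟩
  map_one' := by ext x; simp
  map_mul' f g := by ext x; simp

theorem Diff1Plus.extend_apply_of_mem (f : Diff1Plus) {x : ℝ} (hx : x ∈ Icc (0 : ℝ) 1) :
    Diff1Plus.extend f x = f.1 ⟨x, hx⟩ := by
  classical
  simpa [extend] using Equiv.Perm.ofSubtype_apply_of_mem f.1 hx

theorem Diff1Plus.extend_apply_of_notMem (f : Diff1Plus) {x : ℝ} (hx : x ∉ Icc (0 : ℝ) 1) :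
    Diff1Plus.extend f x = x := by
  classical
  exact Equiv.Perm.ofSubtype_apply_of_not_mem f.1 hx

theorem Diff1Plus.extend_injective : Function.Injective Diff1Plus.extend := by
  intro f g h
  refine Subtype.ext (Equiv.ext fun x => Subtype.ext ?_)
  have := DFunLike.congr_fun h (x : ℝ)
  rwa [extend_apply_of_mem f x.2, extend_apply_of_mem g x.2] at this

theorem Diff1Plus.contDiffOn_extend (f : Diff1Plus) :
    ContDiffOn ℝ 1 (Diff1Plus.extend f) (Icc 0 1) :=
  f.2.2.1.congr fun x hx => by rw [extend_apply_of_mem f hx, projIcc_of_mem zero_le_one hx]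

theorem Diff1Plus.isIntervalDiffeo_extend (f : Diff1Plus) :
    IsIntervalDiffeo (Diff1Plus.extend f) := by
  refine ⟨contDiffOn_extend f, ?_, fun x hx => ?_⟩
  · rw [← map_inv]
    exact contDiffOn_extend f⁻¹
  by_cases hx' : x ∈ Icc (0 : ℝ) 1
  · have hle : ∀ y (hy : y ∈ Icc (0 : ℝ) 1), extend f y ∈ Icc (0 : ℝ) 1 ∧
        extend f⁻¹ y ∈ Icc (0 : ℝ) 1 := fun y hy => by
      rw [extend_apply_of_mem f hy, extend_apply_of_mem f⁻¹ hy]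
      exact ⟨(f.1 _).2, (f⁻¹.1 _).2⟩
    have hinv : extend f (extend f⁻¹ x) = x := by
      rw [map_inv, RelIso.apply_inv_self]
    obtain ⟨h1, h2⟩ := hle x hx'
    have hx01 : x = 0 ∨ x = 1 := by
      by_contra! h
      exact hx ⟨hx'.1.lt_of_ne h.1.symm, hx'.2.lt_of_ne h.2⟩
    rcases hx01 with rfl | rfl
    · exact le_antisymm (((extend f).monotone h2.1).trans_eq hinv) h1.1
    · exact le_antisymm h1.2 (hinv.symm.trans_le ((extend f).monotone h2.2))
  · exact extend_apply_of_notMem f hx'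

/-! ### Reduction mod 2. -/

theorem isSolvable_SL_two_zmod_two : Group.IsSolvable SL(2, ZMod 2) := by
  have hval : ∀ A B : SL(2, ZMod 2), ∀ i j, (A * B) i j = A i 0 * B 0 j + A i 1 * B 1 j :=
    fun A B i j => by rw [Matrix.SpecialLinearGroup.coe_mul, Matrix.mul_apply, Fin.sum_univ_two]
  -- The sign character of `SL(2, ZMod 2) ≅ S₃`: it is 1 exactly on non-identity matrices of trace
  -- 0, the involutions.
  let sgn : SL(2, ZMod 2) → ZMod 2 := fun A =>
    (1 + A 0 0 + A 1 1) * (A 0 1 + A 1 0 + A 0 1 * A 1 0)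
  have hdet : ∀ A : SL(2, ZMod 2), A 0 0 * A 1 1 - A 0 1 * A 1 0 = 1 := fun A => by
    rw [← Matrix.det_fin_two]; exact A.det_coe
  let χ : SL(2, ZMod 2) →* Multiplicative (ZMod 2) :=
    { toFun := fun A => .ofAdd (sgn A)
      map_one' := by simp [sgn]
      map_mul' := fun A B => by
        rw [← ofAdd_add]
        congr 1
        have hA := hdet A
        have hB := hdet B
        simp only [sgn, hval]
        generalize A 0 0 = a, A 0 1 = b, A 1 0 = c, A 1 1 = d at *
        generalize B 0 0 = a', B 0 1 = b', B 1 0 = c', B 1 1 = d' at *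
        decide +revert }
  have hker : ∀ A B : χ.ker, A * B = B * A := by
    intro A B
    have hA := hdet A
    have hB := hdet B
    have hA' : sgn A = 0 := congrArg Multiplicative.toAdd A.2
    have hB' : sgn B = 0 := congrArg Multiplicative.toAdd B.2
    refine Subtype.ext (Matrix.SpecialLinearGroup.ext _ _ fun i j => ?_)
    rw [Subgroup.coe_mul, Subgroup.coe_mul, hval, hval]
    simp only [sgn] at hA' hB'
    fin_cases i <;> fin_cases j <;> dsimp <;>
    · generalize (A : SL(2, ZMod 2)) 0 0 = a, (A : SL(2, ZMod 2)) 0 1 = b,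
        (A : SL(2, ZMod 2)) 1 0 = c, (A : SL(2, ZMod 2)) 1 1 = d at *
      generalize (B : SL(2, ZMod 2)) 0 0 = a', (B : SL(2, ZMod 2)) 0 1 = b',
        (B : SL(2, ZMod 2)) 1 0 = c', (B : SL(2, ZMod 2)) 1 1 = d' at *
      decide +revert
  have : Group.IsSolvable χ.ker := Group.isSolvable_of_comm hker
  exact Group.isSolvable_of_ker_le_range χ.ker.subtype χ (by simp)

theorem exists_trace_eq_of_mem_ker {A : SL(2, ℤ)}
    (hA : A ∈ (Matrix.SpecialLinearGroup.map (n := Fin 2) (Int.castRingHom (ZMod 2))).ker) :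
    ∃ k, A 0 0 + A 1 1 = 4 * k + 2 := by
  have h : ∀ i j, ((A i j : ℤ) : ZMod 2) = (1 : Matrix (Fin 2) (Fin 2) (ZMod 2)) i j := by
    intro i j
    have := congrArg (fun B : SL(2, ZMod 2) => B i j) (MonoidHom.mem_ker.1 hA)
    simpa using this
  have h00 : ((A 0 0 - 1 : ℤ) : ZMod 2) = 0 := by push_cast; rw [h]; simp
  have h11 : ((A 1 1 - 1 : ℤ) : ZMod 2) = 0 := by push_cast; rw [h]; simp
  have h01 : ((A 0 1 : ℤ) : ZMod 2) = 0 := by rw [h]; simp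
  have h10 : ((A 1 0 : ℤ) : ZMod 2) = 0 := by rw [h]; simp
  rw [ZMod.intCast_zmod_eq_zero_iff_dvd] at h00 h11 h01 h10
  obtain ⟨p, hp⟩ := h00
  obtain ⟨s, hs⟩ := h11
  obtain ⟨q, hq⟩ := h01
  obtain ⟨r, hr⟩ := h10
  have hdet := A.det_coe
  rw [Matrix.det_fin_two, hq, hr, eq_add_of_sub_eq hp, eq_add_of_sub_eq hs] at hdet
  push_cast at hp hs hdet
  refine ⟨q * r - p * s, ?_⟩
  linear_combination hp + hs + hdet

/-! ### Passage to integer matrices and conclusion. -/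

/-- The inclusion of `ℤ²` as the standard lattice. -/
def toIntLattice : (Fin 2 → ℤ) →+ intLattice where
  toFun v := ⟨fun i => v i, v, fun _ => rfl⟩
  map_zero' := by ext i; simp
  map_add' v w := by ext i; simp

theorem PreservesIntLattice.exists_map_eq {Γ : Subgroup SL(2, ℝ)} (hΓ : PreservesIntLattice Γ)
    {A : SL(2, ℝ)} (hA : A ∈ Γ) : ∃ B : SL(2, ℤ), B.map (Int.castRingHom ℝ) = A := by
  have h : ∀ j, ∃ w : Fin 2 → ℤ, ∀ i, A i j = w i := by
    intro j
    obtain ⟨w, hw⟩ := hΓ A hA (Pi.single j 1) ⟨Pi.single j 1, fun i => by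
      by_cases hij : i = j <;> simp [hij]⟩
    exact ⟨w, fun i => by rw [← hw]; simp⟩
  choose w hw using h
  refine ⟨⟨Matrix.of fun i j => w j i, ?_⟩, ?_⟩
  · have hdet := A.det_coe
    rw [Matrix.det_fin_two] at hdet ⊢
    rw [hw, hw, hw, hw] at hdet
    exact_mod_cast hdet
  · ext i j
    exact (hw j i).symm

theorem mainTheorem8 (Γ : Subgroup SL(2, ℝ)) (hΓ : PreservesIntLattice Γ)
    (hsolv : ¬ Group.IsSolvable Γ) :
    ¬ ∃ ρ : LatticeSemidirect Γ hΓ →* Diff1Plus, Function.Injective ρ := by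
  rintro ⟨ρ, hρ⟩
  apply hsolv
  let π : SL(2, ℤ) →* SL(2, ℝ) := Matrix.SpecialLinearGroup.map (Int.castRingHom ℝ)
  let red : SL(2, ℤ) →* SL(2, ZMod 2) := Matrix.SpecialLinearGroup.map (Int.castRingHom (ZMod 2))
  let Δ : Subgroup SL(2, ℤ) := Γ.comap π ⊓ red.ker
  let Φ : LatticeSemidirect Γ hΓ →* (ℝ ≃o ℝ) := Diff1Plus.extend.comp ρ
  have hΦ : ∀ x, IsIntervalDiffeo (Φ x) := fun x => Diff1Plus.isIntervalDiffeo_extend _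
  have hΦinj : Function.Injective Φ := Diff1Plus.extend_injective.comp hρ
  let ψ : Multiplicative (Fin 2 → ℤ) →* (ℝ ≃o ℝ) :=
    Φ.comp (SemidirectProduct.inl.comp (AddMonoidHom.toMultiplicative toIntLattice))
  let toΓ : Γ.comap π →* Γ := π.subgroupComap Γ
  let θ : Δ →* (ℝ ≃o ℝ) :=
    Φ.comp (SemidirectProduct.inr.comp (toΓ.comp (Subgroup.inclusion inf_le_left)))
  have hΔ : Group.IsSolvable Δ := by
    refine isSolvable_of_action (ψ := ψ) (θ := θ) (fun v => hΦ _) (fun A => hΦ _)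
      (fun A v => ?_) (fun h => ?_) fun A hA => exists_trace_eq_of_mem_ker hA.2
    · simp only [θ, ψ, MonoidHom.comp_apply]
      rw [← map_inv, ← map_mul, ← map_mul, ← map_inv, ← SemidirectProduct.inl_aut]
      congr 2
      refine Multiplicative.toAdd.injective (Subtype.ext (funext fun i => ?_))
      change (A.1.1.map (Int.castRingHom ℝ)).mulVec (fun j => (v j : ℝ)) i =
        ((A.1.1.mulVec v i : ℤ) : ℝ)
      simp [Matrix.mulVec, dotProduct]
    · have h1 : ψ (.ofAdd ![1, 0]) = ψ 1 := by rw [h]; rfl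
      have h2 := SemidirectProduct.inl_injective (hΦinj h1)
      have h3 := congrFun (congrArg Subtype.val (congrArg Multiplicative.toAdd h2)) 0
      simp [toIntLattice] at h3
  -- `Δ` is the kernel of reduction mod 2 on `Γ.comap π`, so solvability passes up the extension.
  have : Group.IsSolvable (Γ.comap π) := by
    have := isSolvable_SL_two_zmod_two
    refine Group.isSolvable_of_ker_le_range (Subgroup.inclusion (inf_le_left : Δ ≤ Γ.comap π))
      (red.comp (Γ.comap π).subtype) fun A hA => ?_
    exact ⟨⟨A.1, A.2, hA⟩, rfl⟩
  refine Group.isSolvable_of_surjective (f := toΓ) fun A => ?_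
  obtain ⟨B, hB⟩ := hΓ.exists_map_eq A.2
  exact ⟨⟨B, by rw [Subgroup.mem_comap]; exact hB ▸ A.2⟩, Subtype.ext hB⟩
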